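/- Let $\mathbb F=\mathbb R$ or $\mathbb F=\mathbb C$, let $m\ge 1$, and let $\{\mathcal B_k\}_{k\in K}$ be a family of orthonormal bases $\mathcal B_k=\{b^{(k)}_j\}_{j=1}^m$ of $\mathbb F^m$ that are mutually unbiased, that is, $|\langle b^{(k)}_j,b^{(k')}_{j'}\rangle|^2=\frac1m$ for all $k\neq k'$ and all $j,j'$. Suppose that $|K|=\frac m2+1$ if $\mathbb F=\mathbb R$, or $|K|=m+1$ if $\mathbb F=\mathbb C$. Then the family of rank-one projections $P^{(k)}_j=b^{(k)}_j\otimes (b^{(k)}_j)^*$ ($k\in K$, $1\le j\le m$) is a Grassmannian $2$-design. That is, it is a fusion frame of $|K|\,m$ orthogonal projections of rank one (there are $0<A\le B$ with $A\|x\|^2\le\sum_{k,j}\|P^{(k)}_jx\|^2\le B\|x\|^2$ for all $x\in\mathbb F^m$), and $$\sum_{k\in K}\sum_{j=1}^m P^{(k)}_j\otimes P^{(k)}_j=\sum_{k\in K}\sum_{j=1}^m (UP^{(k)}_jU^*)\otimes(UP^{(k)}_jU^*)$$ for every orthogonal (if $\mathbb F=\mathbb R$) or unitary (if $\mathbb F=\mathbb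 C$) $m\times m$ matrix $U$. -/

import Mathlib

open scoped BigOperators

/-- The `t`-fold Kronecker (tensor) power of a square matrix with itself. The rows and columns of
`A ⊗ ⋯ ⊗ A` are indexed by `t`-tuples of indices, and the entry at `(a, b)` is
`A (a 0) (b 0) * ⋯ * A (a (t - 1)) (b (t - 1))`. -/
def kroneckerPower {𝕜 : Type*} [CommMonoid 𝕜] {m : ℕ} (t : ℕ) (A : Matrix (Fin m) (Fin m) 𝕜) :
    Matrix (Fin t → Fin m) (Fin t → Fin m) 𝕜 :=
  Matrix.of fun a b => ∏ s : Fin t, A (a s) (b s)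

/-- For `t = 2` the Kronecker power is Mathlib's Kronecker product of the matrix with itself,
after identifying pairs of indices with functions on `Fin 2`. -/
theorem kroneckerPower_two {𝕜 : Type*} [CommRing 𝕜] {m : ℕ} (A : Matrix (Fin m) (Fin m) 𝕜) :
    kroneckerPower 2 A =
      Matrix.reindex (finTwoArrowEquiv (Fin m)).symm (finTwoArrowEquiv (Fin m)).symm
        (Matrix.kronecker A A) := by
  ext a b
  simp [kroneckerPower, finTwoArrowEquiv, Matrix.kronecker, Fin.prod_univ_two]

/-- An `(n, l, m)`-fusion frame for `𝕜 ^ m`: a family of `n` orthogonal projections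
(self-adjoint idempotent `m × m` matrices) of rank `l` with frame bounds `0 < A ≤ B`. -/
structure IsFusionFrame {𝕜 : Type*} [RCLike 𝕜] {ι : Type*} [Fintype ι] (n l m : ℕ)
    (P : ι → Matrix (Fin m) (Fin m) 𝕜) : Prop where
  card_eq : Fintype.card ι = n
  isStarProjection : ∀ i, IsStarProjection (P i)
  rank_eq : ∀ i, (P i).rank = l
  frame_bounds : ∃ A B : ℝ, 0 < A ∧ A ≤ B ∧ ∀ x : EuclideanSpace 𝕜 (Fin m),
    A * ‖x‖ ^ 2 ≤ ∑ i, ‖Matrix.toEuclideanLin (P i) x‖ ^ 2 ∧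
      ∑ i, ‖Matrix.toEuclideanLin (P i) x‖ ^ 2 ≤ B * ‖x‖ ^ 2

/-- An `(n, l, m)`-fusion frame `P` is a Grassmannian `t`-design if the sum of the `t`-fold
tensor powers of its projections does not change when all of them are conjugated by
the same orthogonal (`𝕜 = ℝ`) or unitary (`𝕜 = ℂ`) matrix `U`. -/
structure IsGrassmannianDesign {𝕜 : Type*} [RCLike 𝕜] {ι : Type*} [Fintype ι] (t n l m : ℕ)
    (P : ι → Matrix (Fin m) (Fin m) 𝕜) : Prop where
  isFusionFrame : IsFusionFrame n l m P
  sum_eq : ∀ U ∈ Matrix.unitaryGroup (Fin m) 𝕜,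
    ∑ i, kroneckerPower t (P i) = ∑ i, kroneckerPower t (U * P i * U.conjTranspose)

/-- Two orthonormal bases of `𝕜 ^ m` are mutually unbiased. -/
def MutuallyUnbiased {𝕜 : Type*} [RCLike 𝕜] {m : ℕ}
    (B B' : OrthonormalBasis (Fin m) 𝕜 (EuclideanSpace 𝕜 (Fin m))) : Prop :=
  ∀ j j' : Fin m, ‖inner 𝕜 (B j) (B' j')‖ ^ 2 = 1 / (m : ℝ)

/-- A set of mutually unbiased bases, as a family indexed by `K`. -/
def AreMutuallyUnbiasedBases {𝕜 : Type*} [RCLike 𝕜] {m : ℕ} {K : Type*}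
    (B : K → OrthonormalBasis (Fin m) 𝕜 (EuclideanSpace 𝕜 (Fin m))) : Prop :=
  ∀ k k' : K, k ≠ k' → MutuallyUnbiased (B k) (B k')

/-- The matrix `v ⊗ v*`, with entries `v i * conj (v j)`; for a unit vector `v` this is the
orthogonal projection onto the line spanned by `v`. -/
def rankOneProj {𝕜 : Type*} [RCLike 𝕜] {m : ℕ} (v : EuclideanSpace 𝕜 (Fin m)) :
    Matrix (Fin m) (Fin m) 𝕜 :=
  Matrix.of fun i j => v i * star (v j)

-- Let `S` be the sum of the second tensor powers and `T` the expected average: `idAddSwap` over ℂ,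
-- half of `idAddSwap + contraction` over ℝ. The inner products `⟨S, S⟩`, `⟨S, T⟩` and `⟨T, T⟩`
-- depend only on the overlaps of the vectors, on `m` and on `|K|`. For the prescribed `|K|` they
-- coincide, so `‖S - T‖² = 0` and `S = T` (equality in a Welch-type bound). A unitary `U` preserves
-- overlaps, so the rotated family has the same sum `T`. The two cases are
-- `sum_doubleTensor_complex` and `sum_doubleTensor_real`.

/-- The coordinates `v a * v b * conj (v c) * conj (v d)` of the second tensor power of `v ⊗ v*`. -/
def doubleTensor {𝕜 : Type*} [RCLike 𝕜] {m : ℕ} (v : Fin m → 𝕜) :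
    Fin m × Fin m × Fin m × Fin m → 𝕜 :=
  fun x => v x.1 * v x.2.1 * (star (v x.2.2.1) * star (v x.2.2.2))

/-- The coordinates of the sum of the identity and the swap of `𝕜 ^ m ⊗ 𝕜 ^ m`. -/
def idAddSwap (𝕜 : Type*) [RCLike 𝕜] (m : ℕ) : Fin m × Fin m × Fin m × Fin m → 𝕜 :=
  fun x => (if x.1 = x.2.2.1 then 1 else 0) * (if x.2.1 = x.2.2.2 then 1 else 0) +
    (if x.1 = x.2.2.2 then 1 else 0) * (if x.2.1 = x.2.2.1 then 1 else 0)

/-- The coordinates of `∑ i j, (eᵢ ⊗ eᵢ) (eⱼ ⊗ eⱼ)*`. -/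
def contraction (𝕜 : Type*) [RCLike 𝕜] (m : ℕ) : Fin m × Fin m × Fin m × Fin m → 𝕜 :=
  fun x => (if x.1 = x.2.1 then 1 else 0) * (if x.2.2.1 = x.2.2.2 then 1 else 0)

section

variable {𝕜 : Type*} [RCLike 𝕜] {m : ℕ}

theorem star_idAddSwap : star (idAddSwap 𝕜 m) = idAddSwap 𝕜 m := by
  ext x
  simp only [Pi.star_apply, idAddSwap, star_add, star_mul', apply_ite star, star_one, star_zero]

theorem star_contraction : star (contraction 𝕜 m) = contraction 𝕜 m := by
  ext x
  simp only [Pi.star_apply, contraction, star_mul', apply_ite star, star_one, star_zero]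

theorem doubleTensor_dotProduct (v w : Fin m → 𝕜) :
    doubleTensor v ⬝ᵥ star (doubleTensor w) = (((‖v ⬝ᵥ star w‖ ^ 2) ^ 2 : ℝ) : 𝕜) := by
  have h : star (v ⬝ᵥ star w) = star v ⬝ᵥ w := by
    simp [dotProduct, star_sum]
  have h1 : (((‖v ⬝ᵥ star w‖ ^ 2) ^ 2 : ℝ) : 𝕜) =
      (v ⬝ᵥ star w) * ((v ⬝ᵥ star w) * ((star v ⬝ᵥ w) * (star v ⬝ᵥ w))) := by
    rw [← h]
    push_cast
    rw [← RCLike.mul_conj]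
    simp only [RCLike.star_def]
    ring
  rw [h1]
  calc doubleTensor v ⬝ᵥ star (doubleTensor w) =
      ∑ a, ∑ b, ∑ c, ∑ d, (v a * star (w a)) * ((v b * star (w b)) *
        ((star (v c) * w c) * (star (v d) * w d))) := by
        simp only [dotProduct, doubleTensor, Pi.star_apply, star_mul', star_star,
          Fintype.sum_prod_type]
        refine Finset.sum_congr rfl fun a _ => Finset.sum_congr rfl fun b _ =>
          Finset.sum_congr rfl fun c _ => Finset.sum_congr rfl fun d _ => ?_
        ring
    _ = _ := by
        simp only [← Finset.mul_sum, ← Finset.sum_mul]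
        rfl

theorem doubleTensor_dotProduct_idAddSwap (v : Fin m → 𝕜) :
    doubleTensor v ⬝ᵥ idAddSwap 𝕜 m = 2 * (v ⬝ᵥ star v) ^ 2 := by
  simp only [dotProduct, doubleTensor, idAddSwap, Pi.star_apply, Fintype.sum_prod_type, mul_add,
    Finset.sum_add_distrib, two_mul, sq, Finset.sum_mul_sum]
  congr 1 <;> refine Finset.sum_congr rfl fun a _ => Finset.sum_congr rfl fun b _ => ?_
  · simp; ring
  · simp; ring

theorem doubleTensor_dotProduct_contraction (v : Fin m → 𝕜) :
    doubleTensor v ⬝ᵥ contraction 𝕜 m = (v ⬝ᵥ v) * star (v ⬝ᵥ v) := by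
  simp only [dotProduct, doubleTensor, contraction, Fintype.sum_prod_type, star_sum,
    Finset.sum_mul_sum]
  simp [star_mul', mul_assoc]

theorem idAddSwap_dotProduct_self :
    idAddSwap 𝕜 m ⬝ᵥ idAddSwap 𝕜 m = 2 * (m : 𝕜) ^ 2 + 2 * m := by
  simp only [dotProduct, idAddSwap, Fintype.sum_prod_type, mul_add, add_mul,
    Finset.sum_add_distrib]
  simp
  ring

theorem idAddSwap_dotProduct_contraction :
    idAddSwap 𝕜 m ⬝ᵥ contraction 𝕜 m = 2 * (m : 𝕜) := by
  simp only [dotProduct, idAddSwap, contraction, Fintype.sum_prod_type, add_mul,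
    Finset.sum_add_distrib]
  simp
  ring

theorem contraction_dotProduct_self :
    contraction 𝕜 m ⬝ᵥ contraction 𝕜 m = (m : 𝕜) ^ 2 := by
  simp only [dotProduct, contraction, Fintype.sum_prod_type]
  simp
  ring

/-- The squared overlaps of the vectors of a family of mutually unbiased bases. -/
def HasUnbiasedOverlaps {K : Type*} (v : K × Fin m → Fin m → 𝕜) : Prop :=
  (∀ p, v p ⬝ᵥ star (v p) = 1) ∧ (∀ k i j, i ≠ j → v (k, i) ⬝ᵥ star (v (k, j)) = 0) ∧
    ∀ k l i j, k ≠ l → ‖v (k, i) ⬝ᵥ star (v (l, j))‖ ^ 2 = 1 / (m : ℝ)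

variable {K : Type*}

theorem HasUnbiasedOverlaps.mulVec {v : K × Fin m → Fin m → 𝕜} (hv : HasUnbiasedOverlaps v)
    {U : Matrix (Fin m) (Fin m) 𝕜} (hU : U ∈ Matrix.unitaryGroup (Fin m) 𝕜) :
    HasUnbiasedOverlaps fun p => U.mulVec (v p) := by
  have h : ∀ x y : Fin m → 𝕜, U.mulVec x ⬝ᵥ star (U.mulVec y) = x ⬝ᵥ star y := by
    intro x y
    rw [Matrix.star_mulVec, dotProduct_comm, ← Matrix.dotProduct_mulVec, Matrix.mulVec_mulVec,
      ← Matrix.star_eq_conjTranspose, Matrix.mem_unitaryGroup_iff'.1 hU, Matrix.one_mulVec,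
      dotProduct_comm]
  simpa only [HasUnbiasedOverlaps, h] using hv

theorem AreMutuallyUnbiasedBases.hasUnbiasedOverlaps
    {B : K → OrthonormalBasis (Fin m) 𝕜 (EuclideanSpace 𝕜 (Fin m))}
    (hB : AreMutuallyUnbiasedBases B) :
    HasUnbiasedOverlaps fun p : K × Fin m => (B p.1 p.2).ofLp := by
  have h : ∀ x y : EuclideanSpace 𝕜 (Fin m), x.ofLp ⬝ᵥ star y.ofLp = inner 𝕜 y x :=
    fun x y => (EuclideanSpace.inner_eq_star_dotProduct y x).symm
  refine ⟨fun p => ?_, fun k i j hij => ?_, fun k l i j hkl => ?_⟩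
  · simp [h]
  · rw [h, OrthonormalBasis.inner_eq_zero _ hij.symm]
  · rw [h]
    exact hB l k hkl.symm j i

variable [Fintype K]

/-- Each of the `|K| m` vectors contributes `1` from itself, `0` from the rest of its basis, and `m
· (1/m)² = 1/m` from each other basis. -/
theorem HasUnbiasedOverlaps.sum_doubleTensor_dotProduct {v : K × Fin m → Fin m → 𝕜}
    (hv : HasUnbiasedOverlaps v) (hm : m ≠ 0) :
    (∑ p, doubleTensor (v p)) ⬝ᵥ star (∑ p, doubleTensor (v p)) =
      (Fintype.card K : 𝕜) * (m + (Fintype.card K - 1)) := by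
  classical
  obtain ⟨h1, h2, h3⟩ := hv
  have hm' : (m : ℝ) ≠ 0 := by exact_mod_cast hm
  have key : ∀ k i, ∑ q : K × Fin m, (‖v (k, i) ⬝ᵥ star (v q)‖ ^ 2) ^ 2 =
      1 + ((Fintype.card K : ℝ) - 1) / m := by
    intro k i
    rw [Fintype.sum_prod_type, ← Finset.add_sum_erase _ _ (Finset.mem_univ k)]
    congr 1
    · rw [Finset.sum_eq_single i]
      · simp [h1]
      · intro j _ hj
        simp [h2 k i j hj.symm]
      · simp
    · rw [Finset.sum_congr rfl (g := fun _ => 1 / (m : ℝ))]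
      · have : 1 ≤ Fintype.card K := Fintype.card_pos_iff.2 ⟨k⟩
        rw [Finset.sum_const, Finset.card_erase_of_mem (Finset.mem_univ k), Finset.card_univ,
          nsmul_eq_mul, Nat.cast_sub this]
        simp [div_eq_mul_inv]
      · intro l hl
        simp only [h3 k l i _ (Finset.ne_of_mem_erase hl).symm]
        simp
        field_simp
  simp only [star_sum, sum_dotProduct, dotProduct_sum, doubleTensor_dotProduct]
  have e : ∀ p, ∑ q, (((‖v p ⬝ᵥ star (v q)‖ ^ 2) ^ 2 : ℝ) : 𝕜) =
      ((1 + ((Fintype.card K : ℝ) - 1) / m : ℝ) : 𝕜) := by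
    rintro ⟨k, i⟩
    rw [← key k i]
    push_cast
    rfl
  have hm'' : (m : 𝕜) ≠ 0 := by exact_mod_cast hm
  rw [Finset.sum_comm]
  simp only [e]
  simp
  field_simp

/-- The hypothesis is the expansion of `‖s - t‖² = 0`. -/
theorem eq_of_dotProduct_star_sub {J : Type*} [Fintype J] {s t : J → 𝕜}
    (h : s ⬝ᵥ star s - s ⬝ᵥ star t - star (s ⬝ᵥ star t) + t ⬝ᵥ star t = 0) : s = t := by
  open scoped ComplexOrder in
  refine sub_eq_zero.1 (dotProduct_self_star_eq_zero.1 ?_)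
  rw [← h, star_sub, sub_dotProduct, dotProduct_sub, dotProduct_sub]
  have : star (s ⬝ᵥ star t) = t ⬝ᵥ star s := by
    rw [← Matrix.star_dotProduct_star, star_star]
  rw [this]
  ring

/-- All three inner products equal `2m(m + 1)`. -/
theorem HasUnbiasedOverlaps.sum_doubleTensor_complex {v : K × Fin m → Fin m → ℂ}
    (hv : HasUnbiasedOverlaps v) (hK : Fintype.card K = m + 1) (hm : m ≠ 0) :
    ∑ p, doubleTensor (v p) = idAddSwap ℂ m := by
  apply eq_of_dotProduct_star_sub
  rw [hv.sum_doubleTensor_dotProduct hm]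
  simp only [star_idAddSwap, sum_dotProduct, doubleTensor_dotProduct_idAddSwap, hv.1,
    idAddSwap_dotProduct_self]
  simp [hK]
  ring

/-- All three inner products equal `3m(m + 2)/4`. For real `v` the pairing with `contraction` is
`‖v‖⁴`, hence the extra term in the target. -/
theorem HasUnbiasedOverlaps.sum_doubleTensor_real {v : K × Fin m → Fin m → ℝ}
    (hv : HasUnbiasedOverlaps v) (hK : (Fintype.card K : ℝ) = (m : ℝ) / 2 + 1) (hm : m ≠ 0) :
    ∑ p, doubleTensor (v p) = (1 / 2 : ℝ) • (idAddSwap ℝ m + contraction ℝ m) := by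
  have h1 : ∀ p, v p ⬝ᵥ v p = 1 := fun p => by simpa using hv.1 p
  apply eq_of_dotProduct_star_sub
  rw [hv.sum_doubleTensor_dotProduct hm]
  simp only [star_smul, star_add, star_idAddSwap, star_contraction, sum_dotProduct, dotProduct_smul,
    smul_dotProduct, dotProduct_add, add_dotProduct, doubleTensor_dotProduct_idAddSwap,
    doubleTensor_dotProduct_contraction, hv.1, h1, idAddSwap_dotProduct_self,
    idAddSwap_dotProduct_contraction, contraction_dotProduct_self,
    dotProduct_comm (contraction ℝ m) (idAddSwap ℝ m)]
  simp [hK]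
  ring

theorem rankOneProj_eq_vecMulVec (v : EuclideanSpace 𝕜 (Fin m)) :
    rankOneProj v = Matrix.vecMulVec v.ofLp (star v.ofLp) := rfl

theorem conj_rankOneProj (U : Matrix (Fin m) (Fin m) 𝕜) (v : EuclideanSpace 𝕜 (Fin m)) :
    U * rankOneProj v * U.conjTranspose = rankOneProj (WithLp.toLp 2 (U.mulVec v.ofLp)) := by
  rw [rankOneProj_eq_vecMulVec, rankOneProj_eq_vecMulVec, Matrix.mul_vecMulVec,
    Matrix.vecMulVec_mul, Matrix.star_mulVec]

theorem kroneckerPower_two_rankOneProj (v : EuclideanSpace 𝕜 (Fin m)) :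
    kroneckerPower 2 (rankOneProj v) =
      Matrix.of fun a b => doubleTensor v.ofLp (a 0, a 1, b 0, b 1) := by
  ext a b
  simp [kroneckerPower, rankOneProj, doubleTensor, Fin.prod_univ_two]
  ring

theorem isStarProjection_rankOneProj {v : EuclideanSpace 𝕜 (Fin m)} (hv : ‖v‖ = 1) :
    IsStarProjection (rankOneProj v) := by
  have h : star v.ofLp ⬝ᵥ v.ofLp = 1 := by
    rw [dotProduct_comm, ← EuclideanSpace.inner_eq_star_dotProduct, inner_self_eq_norm_sq_to_K, hv]
    simp
  rw [rankOneProj_eq_vecMulVec]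
  refine ⟨?_, ?_⟩
  · rw [IsIdempotentElem, Matrix.vecMulVec_mul_vecMulVec, h, one_smul]
  · rw [IsSelfAdjoint, Matrix.star_eq_conjTranspose, Matrix.conjTranspose_vecMulVec, star_star]

theorem rank_rankOneProj {v : EuclideanSpace 𝕜 (Fin m)} (hv : ‖v‖ = 1) :
    (rankOneProj v).rank = 1 := by
  have h : v.ofLp ≠ 0 := by
    rintro h
    have : v = 0 := by ext i; simp [h]
    simp [this] at hv
  rw [rankOneProj_eq_vecMulVec]
  refine le_antisymm (Matrix.rank_vecMulVec_le _ _) (Nat.one_le_iff_ne_zero.2 fun h0 => ?_)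
  rw [Matrix.rank, Submodule.finrank_eq_zero, LinearMap.range_eq_bot, ← Matrix.toLin'_apply',
    LinearEquiv.map_eq_zero_iff] at h0
  exact Matrix.vecMulVec_ne_zero h (star_ne_zero.2 h) h0

theorem toEuclideanLin_rankOneProj (v x : EuclideanSpace 𝕜 (Fin m)) :
    Matrix.toEuclideanLin (rankOneProj v) x = inner 𝕜 v x • v := by
  ext i
  simp [rankOneProj_eq_vecMulVec, Matrix.toLpLin_apply, Matrix.vecMulVec_mulVec,
    EuclideanSpace.inner_eq_star_dotProduct, dotProduct_comm, mul_comm]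

theorem isFusionFrame_rankOneProj [Nonempty K]
    (B : K → OrthonormalBasis (Fin m) 𝕜 (EuclideanSpace 𝕜 (Fin m))) :
    IsFusionFrame (Fintype.card K * m) 1 m (fun p : K × Fin m => rankOneProj (B p.1 p.2)) where
  card_eq := by simp
  isStarProjection p := isStarProjection_rankOneProj (by simp)
  rank_eq p := rank_rankOneProj (by simp)
  frame_bounds := by
    -- By Parseval each basis contributes exactly `‖x‖²`, so the frame is tight with bound `|K|`.
    refine ⟨Fintype.card K, Fintype.card K, by exact_mod_cast Fintype.card_pos, le_rfl, fun x => ?_⟩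
    have h : ∑ p : K × Fin m, ‖Matrix.toEuclideanLin (rankOneProj (B p.1 p.2)) x‖ ^ 2 =
        Fintype.card K * ‖x‖ ^ 2 := by
      simp [toEuclideanLin_rankOneProj, norm_smul, Fintype.sum_prod_type,
        OrthonormalBasis.sum_sq_norm_inner_right]
    exact ⟨h.ge, h.le⟩

/-- If the second tensor power sum is the same for all families with unbiased overlaps, then
mutually unbiased bases give a Grassmannian `2`-design. -/
theorem AreMutuallyUnbiasedBases.isGrassmannianDesign [Nonempty K]
    {B : K → OrthonormalBasis (Fin m) 𝕜 (EuclideanSpace 𝕜 (Fin m))}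
    (hB : AreMutuallyUnbiasedBases B) {T : Fin m × Fin m × Fin m × Fin m → 𝕜}
    (hT : m ≠ 0 → ∀ v : K × Fin m → Fin m → 𝕜, HasUnbiasedOverlaps v →
      ∑ p, doubleTensor (v p) = T) :
    IsGrassmannianDesign 2 (Fintype.card K * m) 1 m
      (fun p : K × Fin m => rankOneProj (B p.1 p.2)) where
  isFusionFrame := isFusionFrame_rankOneProj B
  sum_eq U hU := by
    have hv := hB.hasUnbiasedOverlaps
    ext a b
    -- A matrix entry exists only if `Fin m` is inhabited; for `m = 0` the identity is vacuous.
    have hm : m ≠ 0 := (Nat.zero_le _).trans_lt (a 0).isLt |>.ne'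
    have h := congrFun ((hT hm _ hv).trans (hT hm _ (hv.mulVec hU)).symm) (a 0, a 1, b 0, b 1)
    simpa only [conj_rankOneProj, kroneckerPower_two_rankOneProj, Matrix.sum_apply,
      Matrix.of_apply, Finset.sum_apply] using h

end

theorem mainTheorem12 {K : Type*} [Fintype K] (m : ℕ) :
    (∀ B : K → OrthonormalBasis (Fin m) ℝ (EuclideanSpace ℝ (Fin m)),
      AreMutuallyUnbiasedBases B → (Fintype.card K : ℝ) = (m : ℝ) / 2 + 1 →
        IsGrassmannianDesign 2 (Fintype.card K * m) 1 m
          (fun p : K × Fin m => rankOneProj (B p.1 p.2))) ∧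
    (∀ B : K → OrthonormalBasis (Fin m) ℂ (EuclideanSpace ℂ (Fin m)),
      AreMutuallyUnbiasedBases B → Fintype.card K = m + 1 →
        IsGrassmannianDesign 2 (Fintype.card K * m) 1 m
          (fun p : K × Fin m => rankOneProj (B p.1 p.2))) := by
  constructor
  · intro B hB hK
    have : Nonempty K := Fintype.card_pos_iff.1 (by
      have : (0 : ℝ) < Fintype.card K := by rw [hK]; positivity
      exact_mod_cast this)
    exact hB.isGrassmannianDesign fun hm v hv => hv.sum_doubleTensor_real hK hm
  · intro B hB hK
    have : Nonempty K := Fintype.card_pos_iff.1 (by omega)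
    exact hB.isGrassmannianDesign fun hm v hv => hv.sum_doubleTensor_complex hK hm
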